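/- Definitions. A polytope is the convex hull of finitely many points. A formulation of a polytope $P\subseteq\mathbb{R}^d$ with $m$ additional variables and of size $f$ is a system $Ax+By\le b$ of $f$ linear inequalities in the variables $(x,y)\in\mathbb{R}^d\times\mathbb{R}^m$ whose solution set $Q$ is bounded and satisfies $\{x : \exists y,\ (x,y)\in Q\}=P$. For $\varepsilon\ge 0$, a polytope $P'\subseteq\mathbb{R}^d$ is an $\varepsilon$-approximation of a nonempty polytope $P\subseteq\mathbb{R}^d$ if $P\subseteq P'$ and, for all $c\in\mathbb{R}^d$, $$\max_{x\in P'}cx-\min_{x\in P'}cx\le(1+\varepsilon)\Big(\max_{x\in P}cx-\min_{x\in P}cx\Big).$$ Theorem. Fix a real $\varepsilon>0$ and a polynomial $\sigma\in\mathbb{R}[t]$. There are a constant $C>0$ and $d_0\in\mathbb{N}$, depending only on $\varepsilon$ and $\sigma$, such that the following holds for every integer $d\ge 1$. Let $$P_1=\Big\{x\in\mathbb{R}^d : x\ge 0,\ \sum_{i=1}^d x_i=1\Big\},\qquad P_2=-P_1 .$$ These are nonempty polytopes and (parallel) facets of the cross-polytope $$\Big\{x\in\mathbb{R}^d : \sum_{i\in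 I}x_i-\sum_{i\notin I}x_i\le 1\ \text{ for all } I\subseteq\{1,\dots,d\}\Big\},$$ which equals $\operatorname{conv}(P_1\cup P_2)$. There exist formulations of $P_1$ and $P_2$, of sizes $f_1$ and $f_2$ respectively, such that, if $d\ge d_0$, then for every $\varepsilon$-approximation $P'$ of $\operatorname{conv}(P_1\cup P_2)$, every formulation of $P'$ of size at most $\sigma(f_1+f_2)$ has at least $C\,d/\log d$ additional variables. -/

import Mathlib

open scoped Pointwise Matrix

/-- A polytope: the convex hull of a finite set of points. -/
def IsPolytope {E : Type*} [AddCommGroup E] [Module ℝ E] (P : Set E) : Prop :=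
  ∃ V : Set E, V.Finite ∧ P = convexHull ℝ V

/-- A system `A x + B y ≤ b` of `f` linear inequalities in the `d` original variables `x` and
the `m` additional variables `y`. -/
structure LinSystem (d m f : ℕ) where
  A : Matrix (Fin f) (Fin d) ℝ
  B : Matrix (Fin f) (Fin m) ℝ
  b : Fin f → ℝ

/-- The set of solutions `(x, y)` of the system, a polyhedron in `ℝ^d × ℝ^m`. -/
def LinSystem.solutions {d m f : ℕ} (F : LinSystem d m f) :
    Set ((Fin d → ℝ) × (Fin m → ℝ)) :=
  {z | F.A *ᵥ z.1 + F.B *ᵥ z.2 ≤ F.b}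

/-- `F` is a formulation (of size `f`, with `m` additional variables) of `P ⊆ ℝ^d`: it describes a
polytope, that is, a bounded polyhedron, whose projection onto the `x`-space is `P`. -/
def LinSystem.IsFormulationOf {d m f : ℕ} (F : LinSystem d m f) (P : Set (Fin d → ℝ)) : Prop :=
  Bornology.IsBounded F.solutions ∧ Prod.fst '' F.solutions = P

/-- The width `max_{x ∈ P} c x - min_{x ∈ P} c x` of `P` in direction `c` (only used for nonempty
polytopes, where the supremum and the infimum are attained). -/
noncomputable def dirWidth {d : ℕ} (c : Fin d → ℝ) (P : Set (Fin d → ℝ)) : ℝ :=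
  sSup ((fun x => c ⬝ᵥ x) '' P) - sInf ((fun x => c ⬝ᵥ x) '' P)

/-- `P'` is an `ε`-approximation of the nonempty polytope `P`. -/
structure IsApproximation {d : ℕ} (ε : ℝ) (P P' : Set (Fin d → ℝ)) : Prop where
  polytope : IsPolytope P
  nonempty : P.Nonempty
  polytope' : IsPolytope P'
  subset : P ⊆ P'
  width_le : ∀ c : Fin d → ℝ, dirWidth c P' ≤ (1 + ε) * dirWidth c P

/-- The `d`-dimensional cross-polytope. -/
def crossPolytope (d : ℕ) : Set (Fin d → ℝ) :=
  {x | ∀ I : Finset (Fin d), ∑ i ∈ I, x i - ∑ i ∈ Iᶜ, x i ≤ 1}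

/-- `F` is a facet of the polytope `P`: a nonempty face whose dimension is one less than that
of `P`. -/
def IsFacet {d : ℕ} (P F : Set (Fin d → ℝ)) : Prop :=
  F.Nonempty ∧ IsExposed ℝ P F ∧
    Module.finrank ℝ (vectorSpan ℝ F) + 1 = Module.finrank ℝ (vectorSpan ℝ P)

/-! A formulation with `f` inequalities and `m` additional variables projects to a polyhedron cut
out by at most `(f + 1) ^ (m + 1)` inequalities. By `farkas`, a point lies outside the projection
exactly when a nonnegative certificate says so; certificates of minimal support have at most `m + 1`
nonzero entries and are fixed up to scaling by that support (`exists_finset_certificates`). Put `R =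
2 + 2ε`. The points `(R / d) • {±1} ^ d` all lie outside every `ε`-approximation of the
cross-polytope (`IsApproximation.notMem_of_crossPolytope`). An inequality valid at all `±e_i` has
coefficients bounded by its right-hand side, so by Hoeffding it cuts off at most a fraction `exp (-d
/ (2 R ^ 2))` of these points. Hence `exp (d / (2 R ^ 2)) ≤ (f + 1) ^ (m + 1)`
(`exp_le_of_projection`). The two simplices have formulations of size `d + 2`, so `f` is polynomial
in `d`, and taking logarithms bounds `m` below by a multiple of `d / log d`. -/

/-! ### Farkas' lemma and elementary certificates -/

/-- A finite family of upper and lower bounds on one real variable, pairwise consistent, has a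
solution. -/
lemma exists_forall_mul_le {ι : Type*} [Fintype ι] (a s : ι → ℝ)
    (h0 : ∀ i, a i = 0 → 0 ≤ s i)
    (h1 : ∀ p n, 0 < a p → a n < 0 → 0 ≤ -a n * s p + a p * s n) :
    ∃ t : ℝ, ∀ i, a i * t ≤ s i := by
  classical
  by_cases hn : ∃ n, a n < 0
  · obtain ⟨n, hn, hmax⟩ := Finset.exists_max_image
      (Finset.univ.filter fun i => a i < 0) (fun i => s i / a i)
      (by obtain ⟨n, hn⟩ := hn; exact ⟨n, by simpa using hn⟩)
    simp only [Finset.mem_filter, Finset.mem_univ, true_and] at hn hmax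
    -- This is the largest lower bound; by `h1` no upper bound lies below it.
    refine ⟨s n / a n, fun i => ?_⟩
    rcases lt_trichotomy (a i) 0 with hi | hi | hi
    · have := hmax i hi
      have := mul_le_mul_of_nonpos_left this hi.le
      rwa [mul_div_cancel₀ _ hi.ne] at this
    · simpa [hi] using h0 i hi
    · have := h1 i n hi hn
      rw [mul_div_assoc', div_le_iff_of_neg hn]
      linarith
  · push Not at hn
    by_cases hp : ∃ p, 0 < a p
    · obtain ⟨p, hp, hmin⟩ := Finset.exists_min_image
        (Finset.univ.filter fun i => 0 < a i) (fun i => s i / a i)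
        (by obtain ⟨n, hn⟩ := hp; exact ⟨n, by simpa using hn⟩)
      simp only [Finset.mem_filter, Finset.mem_univ, true_and] at hp hmin
      refine ⟨s p / a p, fun i => ?_⟩
      rcases (hn i).eq_or_lt with hi | hi
      · simpa [← hi] using h0 i hi.symm
      · have := mul_le_mul_of_nonneg_left (hmin i hi) hi.le
        rwa [mul_div_cancel₀ _ hi.ne'] at this
    · push Not at hp
      exact ⟨0, fun i => by simpa using h0 i (le_antisymm (hp i) (hn i))⟩

/-- **Farkas' lemma**, by Fourier–Motzkin elimination. -/
theorem farkas {m : ℕ} {ι : Type} [Fintype ι] (B : Matrix ι (Fin m) ℝ) (r : ι → ℝ)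
    (h : ¬ ∃ y, B *ᵥ y ≤ r) : ∃ l : ι → ℝ, 0 ≤ l ∧ l ᵥ* B = 0 ∧ l ⬝ᵥ r < 0 := by
  classical
  induction m generalizing ι with
  | zero =>
    have : ∃ i, r i < 0 := by
      by_contra! hr
      exact h ⟨0, fun i => by simpa using hr i⟩
    obtain ⟨i, hi⟩ := this
    exact ⟨Pi.single i 1, Pi.single_nonneg.2 zero_le_one, Subsingleton.elim _ _, by simpa using hi⟩
  | succ m ih =>
    let a : ι → ℝ := fun i => B i 0
    let B₁ : Matrix ι (Fin m) ℝ := Matrix.of fun i j => B i j.succ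
    -- The rows of `W` are the nonnegative combinations that eliminate variable `0`. Irrelevant
    -- indices and pairs get a zero row, which is harmless and keeps the index type simple.
    let W : Matrix (ι ⊕ ι × ι) ι ℝ := Matrix.of <| Sum.elim
      (fun i => if a i = 0 then Pi.single i 1 else 0)
      (fun q => if 0 < a q.1 ∧ a q.2 < 0 then
        (-a q.2) • Pi.single q.1 1 + a q.1 • Pi.single q.2 1 else 0)
    have hW0 : ∀ k i, 0 ≤ W k i := by
      have hs : ∀ i j : ι, (0 : ℝ) ≤ (Pi.single i 1 : ι → ℝ) j := fun i j => by
        rw [Pi.single_apply]; split_ifs <;> norm_num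
      rintro (i | ⟨p, n⟩) j
      · simp only [W, Matrix.of_apply, Sum.elim_inl]
        split_ifs
        · exact hs i j
        · exact le_rfl
      · simp only [W, Matrix.of_apply, Sum.elim_inr]
        split_ifs with hq
        · have h1 := mul_nonneg (neg_nonneg.2 hq.2.le) (hs p j)
          have h2 := mul_nonneg hq.1.le (hs n j)
          simpa using add_nonneg h1 h2
        · exact le_rfl
    have hWa : W *ᵥ a = 0 := by
      funext k
      rcases k with i | ⟨p, n⟩
      · by_cases hi : a i = 0 <;> simp [W, Matrix.mulVec, hi]
      · by_cases hq : 0 < a p ∧ a n < 0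
        · simp only [W, Matrix.mulVec, Matrix.of_apply, Sum.elim_inr, if_pos hq, add_dotProduct,
            smul_dotProduct, single_dotProduct, Pi.zero_apply, smul_eq_mul]
          ring
        · simp [W, Matrix.mulVec, hq]
    have hinf : ¬ ∃ y, (W * B₁) *ᵥ y ≤ W *ᵥ r := by
      rintro ⟨y, hy⟩
      have hs : ∀ k, 0 ≤ (W *ᵥ (r - B₁ *ᵥ y)) k := fun k => by
        have := hy k
        rw [← Matrix.mulVec_mulVec] at this
        rw [Matrix.mulVec_sub, Pi.sub_apply]
        linarith
      obtain ⟨t, ht⟩ := exists_forall_mul_le a (r - B₁ *ᵥ y)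
        (fun i hi => by simpa [W, Matrix.mulVec, hi] using hs (Sum.inl i))
        (fun p n hp hn => by
          have := hs (Sum.inr (p, n))
          simp only [W, Matrix.mulVec, Matrix.of_apply, Sum.elim_inr, if_pos (And.intro hp hn),
            add_dotProduct, smul_dotProduct, single_dotProduct, smul_eq_mul, one_mul] at this
          exact this)
      refine h ⟨Fin.cons t y, fun i => ?_⟩
      have := ht i
      simp only [Matrix.mulVec, dotProduct, Fin.sum_univ_succ, Fin.cons_zero, Fin.cons_succ,
        Pi.sub_apply, a, B₁, Matrix.of_apply] at this ⊢
      linarith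
    obtain ⟨l, hl0, hlB, hlr⟩ := ih (W * B₁) (W *ᵥ r) hinf
    refine ⟨l ᵥ* W, fun i => ?_, ?_, ?_⟩
    · exact Finset.sum_nonneg fun k _ => mul_nonneg (hl0 k) (hW0 k i)
    · funext j
      refine Fin.cases ?_ (fun j => ?_) j
      · have : l ᵥ* W ⬝ᵥ a = 0 := by rw [← Matrix.dotProduct_mulVec, hWa, dotProduct_zero]
        exact this
      · have := congrFun hlB j
        rw [← Matrix.vecMul_vecMul] at this
        exact this
    · rwa [← Matrix.dotProduct_mulVec]

/-- From a nonnegative vector one can move along a direction with a negative entry until a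
positive entry vanishes, keeping nonnegativity. -/
lemma exists_add_smul_nonneg {ι : Type*} [Fintype ι] (l v : ι → ℝ) (hl : 0 ≤ l)
    (hv : ∀ i, l i = 0 → v i = 0) (hneg : ∃ i, v i < 0) :
    ∃ t : ℝ, 0 ≤ l + t • v ∧ ∃ i, l i ≠ 0 ∧ (l + t • v) i = 0 := by
  classical
  obtain ⟨n, hn, hmin⟩ := Finset.exists_min_image
    (Finset.univ.filter fun i => v i < 0) (fun i => l i / (-v i))
    (by obtain ⟨n, hn⟩ := hneg; exact ⟨n, by simpa using hn⟩)
  simp only [Finset.mem_filter, Finset.mem_univ, true_and] at hn hmin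
  have ht : 0 ≤ l n / (-v n) := div_nonneg (hl n) (neg_nonneg.2 hn.le)
  refine ⟨l n / (-v n), fun i => ?_, n, fun h => hn.ne (hv n h), ?_⟩
  · simp only [Pi.zero_apply, Pi.add_apply, Pi.smul_apply, smul_eq_mul]
    rcases lt_or_ge (v i) 0 with hi | hi
    · have := hmin i hi
      rw [le_div_iff₀ (neg_pos.2 hi)] at this
      linarith
    · have := mul_nonneg ht hi
      have := hl i
      simp only [Pi.zero_apply] at this
      linarith
  · simp only [Pi.add_apply, Pi.smul_apply, smul_eq_mul]
    have := hn.ne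
    field_simp
    ring

/-- A Farkas certificate of minimal support is elementary: it has at most `m + 1` nonzero
entries, and is determined up to scaling by its support. -/
theorem exists_elementary_certificate {m : ℕ} {ι : Type} [Fintype ι] (B : Matrix ι (Fin m) ℝ)
    (r : ι → ℝ) (h : ¬ ∃ y, B *ᵥ y ≤ r) :
    ∃ l : ι → ℝ, 0 ≤ l ∧ l ᵥ* B = 0 ∧ l ⬝ᵥ r < 0 ∧
      (Finset.univ.filter fun i => l i ≠ 0).card ≤ m + 1 ∧
      ∀ μ : ι → ℝ, μ ᵥ* B = 0 → (∀ i, l i = 0 → μ i = 0) → ∃ s : ℝ, μ = s • l := by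
  classical
  let supp : (ι → ℝ) → Finset ι := fun l => Finset.univ.filter fun i => l i ≠ 0
  have hex : ∃ k : ℕ, ∃ l : ι → ℝ, 0 ≤ l ∧ l ᵥ* B = 0 ∧ l ⬝ᵥ r < 0 ∧ (supp l).card = k := by
    obtain ⟨l, h0, hB, hr⟩ := farkas B r h
    exact ⟨_, l, h0, hB, hr, rfl⟩
  obtain ⟨l, h0, hB, hr, hk⟩ := Nat.find_spec hex
  have hmin : ∀ l' : ι → ℝ, 0 ≤ l' → l' ᵥ* B = 0 → l' ⬝ᵥ r < 0 →
      (supp l).card ≤ (supp l').card := fun l' a b c => by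
    rw [hk]; exact Nat.find_min' hex ⟨l', a, b, c, rfl⟩
  -- no nonzero vector on the support of `l` is orthogonal to `B` and `r`
  have key1 : ∀ v : ι → ℝ, v ᵥ* B = 0 → v ⬝ᵥ r = 0 → (∀ i, l i = 0 → v i = 0) →
      ¬ ∃ i, v i < 0 := by
    intro v hvB hvr hv hneg
    obtain ⟨t, ht0, i, hi, hti⟩ := exists_add_smul_nonneg l v h0 hv hneg
    have hle := hmin (l + t • v) ht0 (by rw [Matrix.add_vecMul, Matrix.smul_vecMul, hB, hvB]; simp)
      (by rw [add_dotProduct, smul_dotProduct, hvr]; simpa using hr)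
    have hlt : (supp (l + t • v)).card < (supp l).card := by
      refine Finset.card_lt_card (Finset.ssubset_iff_subset_ne.2 ⟨fun j hj => ?_, fun he => ?_⟩)
      · simp only [supp, Finset.mem_filter, Finset.mem_univ, true_and] at hj ⊢
        intro hlj
        exact hj (by simp [hlj, hv j hlj])
      · have : i ∈ supp (l + t • v) := by rw [he]; simpa [supp] using hi
        simp only [supp, Finset.mem_filter, Finset.mem_univ, true_and] at this
        exact this hti
    omega
  have key : ∀ v : ι → ℝ, v ᵥ* B = 0 → v ⬝ᵥ r = 0 → (∀ i, l i = 0 → v i = 0) → v = 0 := by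
    intro v hvB hvr hv
    have h1 := key1 v hvB hvr hv
    have h2 := key1 (-v) (by rw [Matrix.neg_vecMul, hvB, neg_zero])
      (by rw [neg_dotProduct, hvr, neg_zero]) (fun i hi => by simp [hv i hi])
    push Not at h1 h2
    funext i
    have := h2 i
    simp only [Pi.neg_apply, Left.nonneg_neg_iff] at this
    exact le_antisymm this (h1 i)
  refine ⟨l, h0, hB, hr, ?_, fun μ hμB hμ => ?_⟩
  · by_contra! hcard
    -- By `key`, extension by zero followed by pairing with `B` and `r` is injective, and the target
    -- has dimension `m + 1`.
    let φ : (supp l → ℝ) →ₗ[ℝ] (Fin m → ℝ) × ℝ :=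
      { toFun := fun g =>
          ((fun i => if hi : i ∈ supp l then g ⟨i, hi⟩ else 0) ᵥ* B,
            (fun i => if hi : i ∈ supp l then g ⟨i, hi⟩ else 0) ⬝ᵥ r)
        map_add' := fun g g' => by
          have : (fun i => if hi : i ∈ supp l then (g + g') ⟨i, hi⟩ else 0) =
            (fun i => if hi : i ∈ supp l then g ⟨i, hi⟩ else 0) +
            (fun i => if hi : i ∈ supp l then g' ⟨i, hi⟩ else 0) := by
            funext i; by_cases hi : i ∈ supp l <;> simp [hi]
          rw [this, Matrix.add_vecMul, add_dotProduct]; rfl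
        map_smul' := fun c g => by
          have : (fun i => if hi : i ∈ supp l then (c • g) ⟨i, hi⟩ else 0) =
            c • (fun i => if hi : i ∈ supp l then g ⟨i, hi⟩ else 0) := by
            funext i; by_cases hi : i ∈ supp l <;> simp [hi]
          rw [this, Matrix.smul_vecMul, smul_dotProduct]; rfl }
    have hφ : Function.Injective φ := by
      rw [← LinearMap.ker_eq_bot, LinearMap.ker_eq_bot']
      intro g hg
      have hv := key (fun i => if hi : i ∈ supp l then g ⟨i, hi⟩ else 0)
        (congrArg Prod.fst hg) (congrArg Prod.snd hg) (fun i hi => by simp [supp, hi])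
      funext ⟨i, hi⟩
      have := congrFun hv i
      simpa [hi] using this
    have := LinearMap.finrank_le_finrank_of_injective hφ
    simp only [Module.finrank_fintype_fun_eq_card, Fintype.card_coe, Module.finrank_prod,
      Fintype.card_fin, Module.finrank_self] at this
    exact absurd this (not_le.2 hcard)
  -- The ratio makes `μ - s • l` orthogonal to `r`, so that `key` applies.
  · refine ⟨(μ ⬝ᵥ r) / (l ⬝ᵥ r), ?_⟩
    have := key (μ - ((μ ⬝ᵥ r) / (l ⬝ᵥ r)) • l)
      (by rw [Matrix.sub_vecMul, Matrix.smul_vecMul, hB, hμB]; simp)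
      (by rw [sub_dotProduct, smul_dotProduct, smul_eq_mul, div_mul_cancel₀ _ hr.ne, sub_self])
      (fun i hi => by simp [hi, hμ i hi])
    exact sub_eq_zero.1 this

/-! ### Counting certificates -/

/-- The number of subsets of at most `k` elements of an `f`-set is at most `(f + 1) ^ k`. -/
lemma card_filter_card_le (f k : ℕ) :
    (Finset.univ.filter fun S : Finset (Fin f) => S.card ≤ k).card ≤ (f + 1) ^ k := by
  classical
  have h : (Finset.univ.filter fun S : Finset (Fin f) => S.card ≤ k) ⊆
      Finset.univ.image fun g : Fin k → Option (Fin f) =>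
        Finset.univ.filter fun i => ∃ j, g j = some i := by
    intro S hS
    simp only [Finset.mem_filter, Finset.mem_univ, true_and, Finset.mem_image] at hS ⊢
    obtain ⟨e⟩ : Nonempty (S ↪ Fin k) :=
      Function.Embedding.nonempty_of_card_le (by simpa using hS)
    refine ⟨fun j => if hj : ∃ s : S, e s = j then some hj.choose else none, ?_⟩
    ext i
    simp only [Finset.mem_filter, Finset.mem_univ, true_and]
    constructor
    · rintro ⟨j, hj⟩
      split_ifs at hj with hs
      rw [Option.some_inj] at hj
      exact hj ▸ hs.choose.2
    · intro hi
      have hs : ∃ s : S, e s = e ⟨i, hi⟩ := ⟨_, rfl⟩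
      refine ⟨e ⟨i, hi⟩, ?_⟩
      rw [dif_pos hs, e.injective hs.choose_spec]
  calc _ ≤ _ := Finset.card_le_card h
    _ ≤ _ := Finset.card_image_le
    _ = _ := by simp

/-- Finitely many certificates, at most `(f + 1) ^ (m + 1)`, witness the infeasibility of all
infeasible systems `B y ≤ r` with a fixed matrix `B`. -/
theorem exists_finset_certificates {m f : ℕ} (B : Matrix (Fin f) (Fin m) ℝ) :
    ∃ Λ : Finset (Fin f → ℝ), Λ.card ≤ (f + 1) ^ (m + 1) ∧
      (∀ l ∈ Λ, 0 ≤ l ∧ l ᵥ* B = 0) ∧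
      ∀ r, (¬ ∃ y, B *ᵥ y ≤ r) → ∃ l ∈ Λ, l ⬝ᵥ r < 0 := by
  classical
  -- `Elem` does not mention `r`, so one choice per support serves all right-hand sides.
  let Elem : (Fin f → ℝ) → Finset (Fin f) → Prop := fun l S =>
    0 ≤ l ∧ l ≠ 0 ∧ l ᵥ* B = 0 ∧ (Finset.univ.filter fun i => l i ≠ 0) = S
  let pick : Finset (Fin f) → (Fin f → ℝ) := fun S => if h : ∃ l, Elem l S then h.choose else 0
  refine ⟨(Finset.univ.filter fun S : Finset (Fin f) => S.card ≤ m + 1).image pick,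
    Finset.card_image_le.trans (card_filter_card_le f (m + 1)), ?_, ?_⟩
  · simp only [Finset.mem_image]
    rintro _ ⟨S, -, rfl⟩
    by_cases h : ∃ l, Elem l S
    · simp only [pick, dif_pos h]
      exact ⟨h.choose_spec.1, h.choose_spec.2.2.1⟩
    · simp only [pick, dif_neg h]
      exact ⟨le_rfl, Matrix.zero_vecMul B⟩
  · intro r hr
    obtain ⟨l, h0, hB, hlr, hcard, huniq⟩ := exists_elementary_certificate B r hr
    set S := Finset.univ.filter fun i => l i ≠ 0 with hS
    refine ⟨pick S, Finset.mem_image.2 ⟨S, by simpa using hcard, rfl⟩, ?_⟩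
    have hex : ∃ l, Elem l S := ⟨l, h0, fun h => by simp [h] at hlr, hB, rfl⟩
    have hp : Elem (pick S) S := by simp only [pick, dif_pos hex]; exact hex.choose_spec
    obtain ⟨hp0, hpne, hpB, hpS⟩ := hp
    obtain ⟨s, hs⟩ := huniq (pick S) hpB (fun i hi => by
      by_contra hne
      have : i ∈ S := by rw [← hpS]; simpa using hne
      simp [hS, hi] at this)
    obtain ⟨i, hi⟩ := Function.ne_iff.1 hpne
    have hsl : pick S i = s * l i := by rw [hs]; rfl
    have hspos : 0 < s := by
      have h1 : 0 < s * l i := hsl ▸ lt_of_le_of_ne (hp0 i) (Ne.symm hi)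
      exact pos_of_mul_pos_left h1 (h0 i)
    rw [hs, smul_dotProduct, smul_eq_mul]
    exact mul_neg_of_pos_of_neg hspos hlr

/-! ### Hoeffding's inequality and the exponential lower bound -/

/-- The vector with entries `±1` given by a Boolean vector. -/
def signVec {d : ℕ} (c : Fin d → Bool) : Fin d → ℝ := fun i => if c i then 1 else -1

/-- Hoeffding's inequality for sign vectors. -/
lemma card_filter_lt_dotProduct_signVec {d : ℕ} (a : Fin d → ℝ) {β R : ℝ} (hR : 0 < R)
    (ha : ∀ i, |a i| ≤ β) :
    ((Finset.univ.filter fun c : Fin d → Bool => β * (d / R) < a ⬝ᵥ signVec c).card : ℝ) ≤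
      2 ^ d * Real.exp (-(d / (2 * R ^ 2))) := by
  classical
  rcases Nat.eq_zero_or_pos d with rfl | hd
  · refine (Nat.cast_le.2 (Finset.card_le_univ _)).trans ?_
    simp
  have hβ0 : 0 ≤ β := (abs_nonneg _).trans (ha ⟨0, hd⟩)
  rcases hβ0.eq_or_lt with hβ | hβ
  · have ha0 : a = 0 := by
      funext i
      have := ha i
      rw [← hβ] at this
      exact abs_nonpos_iff.1 this
    rw [Finset.filter_false_of_mem]
    · simp only [Finset.card_empty, Nat.cast_zero]; positivity
    · intro c _
      simp [ha0, ← hβ]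
  -- This minimizes the Chernoff exponent `d * (θ * β) ^ 2 / 2 - θ * β * d / R`.
  let θ : ℝ := 1 / (R * β)
  have hθ : 0 < θ := by positivity
  have hsum : ∑ c : Fin d → Bool, Real.exp (θ * (a ⬝ᵥ signVec c)) =
      ∏ i, (2 * Real.cosh (θ * a i)) := by
    have h1 : ∀ i, 2 * Real.cosh (θ * a i) =
        ∑ b : Bool, Real.exp (θ * (a i * if b then 1 else -1)) := fun i => by
      rw [Real.cosh_eq]; simp; ring
    simp_rw [h1]
    rw [Finset.prod_univ_sum, Fintype.piFinset_univ]
    refine Finset.sum_congr rfl fun c _ => ?_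
    rw [← Real.exp_sum, dotProduct, Finset.mul_sum]
    rfl
  have hupper : ∏ i, (2 * Real.cosh (θ * a i)) ≤ 2 ^ d * Real.exp (d / (2 * R ^ 2)) := by
    have h2 : ∀ i, 2 * Real.cosh (θ * a i) ≤ 2 * Real.exp (1 / (2 * R ^ 2)) := fun i => by
      refine mul_le_mul_of_nonneg_left ((Real.cosh_le_exp_half_sq _).trans ?_) zero_le_two
      refine Real.exp_le_exp.2 ?_
      have h3 : a i ^ 2 ≤ β ^ 2 := sq_le_sq' (abs_le.1 (ha i)).1 (abs_le.1 (ha i)).2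
      calc (θ * a i) ^ 2 / 2 = θ ^ 2 * a i ^ 2 / 2 := by ring
        _ ≤ θ ^ 2 * β ^ 2 / 2 := by gcongr
        _ = 1 / (2 * R ^ 2) := by simp only [θ]; field_simp
    refine (Finset.prod_le_prod (fun i _ => by have := Real.cosh_pos (θ * a i); positivity)
      (fun i _ => h2 i)).trans (le_of_eq ?_)
    rw [Finset.prod_const, Finset.card_univ, Fintype.card_fin, mul_pow, ← Real.exp_nat_mul]
    congr 2
    ring
  have hlower : ((Finset.univ.filter fun c : Fin d → Bool =>
      β * (d / R) < a ⬝ᵥ signVec c).card : ℝ) * Real.exp (d / R ^ 2) ≤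
      ∑ c : Fin d → Bool, Real.exp (θ * (a ⬝ᵥ signVec c)) := by
    rw [← nsmul_eq_mul, ← Finset.sum_const]
    refine (Finset.sum_le_sum fun c hc => ?_).trans
      (Finset.sum_le_sum_of_subset_of_nonneg (Finset.filter_subset _ _)
        fun _ _ _ => (Real.exp_pos _).le)
    refine Real.exp_le_exp.2 ?_
    have hc := (Finset.mem_filter.1 hc).2
    calc (d : ℝ) / R ^ 2 = θ * (β * (d / R)) := by simp only [θ]; field_simp
      _ ≤ _ := by gcongr
  have h := hlower.trans (hsum.le.trans hupper)
  rw [← le_div_iff₀ (Real.exp_pos _), mul_div_assoc, ← Real.exp_sub] at h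
  refine h.trans (le_of_eq ?_)
  congr 2
  field_simp
  ring

/-- A polyhedron given by `f` inequalities with `m` additional variables whose projection
contains the cross-polytope and misses all the points `(R / d) • {±1} ^ d` satisfies
`exp (d / (2 R ^ 2)) ≤ (f + 1) ^ (m + 1)`. -/
theorem exp_le_of_projection {d m f : ℕ} (F : LinSystem d m f) {R : ℝ} (hR : 0 < R) (hd : 0 < d)
    (hin : ∀ i : Fin d, ∀ s : ℝ, |s| = 1 → Pi.single i s ∈ Prod.fst '' F.solutions)
    (hout : ∀ c : Fin d → Bool, (d / R)⁻¹ • signVec c ∉ Prod.fst '' F.solutions) :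
    Real.exp (d / (2 * R ^ 2)) ≤ ((f : ℝ) + 1) ^ (m + 1) := by
  classical
  obtain ⟨Λ, hcard, hΛ, hcert⟩ := exists_finset_certificates F.B
  have hd' : (0 : ℝ) < d := Nat.cast_pos.2 hd
  -- The sign vectors whose scaled points are cut off by the inequality that `l` induces on `x`.
  let T : (Fin f → ℝ) → Finset (Fin d → Bool) := fun l =>
    Finset.univ.filter fun c => (l ⬝ᵥ F.b) * (d / R) < (l ᵥ* F.A) ⬝ᵥ signVec c
  have hT : ∀ l ∈ Λ, ((T l).card : ℝ) ≤ 2 ^ d * Real.exp (-(d / (2 * R ^ 2))) := by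
    intro l hl
    obtain ⟨h0, hB⟩ := hΛ l hl
    refine card_filter_lt_dotProduct_signVec _ hR fun i => ?_
    have hval : ∀ s : ℝ, |s| = 1 → (l ᵥ* F.A) i * s ≤ l ⬝ᵥ F.b := fun s hs => by
      obtain ⟨⟨x, y⟩, hz, hx⟩ := hin i s hs
      have h1 : l ⬝ᵥ (F.A *ᵥ x + F.B *ᵥ y) ≤ l ⬝ᵥ F.b := dotProduct_le_dotProduct_of_nonneg_left hz h0
      rw [dotProduct_add, Matrix.dotProduct_mulVec, Matrix.dotProduct_mulVec, hB, zero_dotProduct,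
        add_zero, show x = Pi.single i s from hx, dotProduct_single] at h1
      exact h1
    refine abs_le.2 ⟨?_, ?_⟩
    · have := hval (-1) (by simp); linarith
    · have := hval 1 (by simp); linarith
  have hcover : (Finset.univ : Finset (Fin d → Bool)) ⊆ Λ.biUnion T := by
    intro c _
    obtain ⟨l, hl, hlr⟩ := hcert (F.b - F.A *ᵥ ((d / R)⁻¹ • signVec c)) (by
      rintro ⟨y, hy⟩
      exact hout c ⟨(_, y), le_sub_iff_add_le'.1 hy, rfl⟩)
    refine Finset.mem_biUnion.2 ⟨l, hl, Finset.mem_filter.2 ⟨Finset.mem_univ _, ?_⟩⟩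
    rw [dotProduct_sub, Matrix.dotProduct_mulVec, dotProduct_smul, smul_eq_mul, sub_neg,
      ← div_eq_inv_mul, lt_div_iff₀ (by positivity)] at hlr
    exact hlr
  have h1 : (2 : ℝ) ^ d ≤ Λ.card * (2 ^ d * Real.exp (-(d / (2 * R ^ 2)))) := by
    calc (2 : ℝ) ^ d = ((Finset.univ : Finset (Fin d → Bool)).card : ℝ) := by simp
      _ ≤ ((Λ.biUnion T).card : ℝ) := Nat.cast_le.2 (Finset.card_le_card hcover)
      _ ≤ ∑ l ∈ Λ, ((T l).card : ℝ) := by exact_mod_cast Finset.card_biUnion_le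
      _ ≤ ∑ l ∈ Λ, (2 ^ d * Real.exp (-(d / (2 * R ^ 2)))) := Finset.sum_le_sum hT
      _ = _ := by rw [Finset.sum_const, nsmul_eq_mul]
  have h2 : (Λ.card : ℝ) ≤ ((f : ℝ) + 1) ^ (m + 1) := by exact_mod_cast hcard
  refine le_trans ?_ h2
  rw [Real.exp_neg] at h1
  have h3 : (0 : ℝ) < 2 ^ d := by positivity
  have h4 := Real.exp_pos (d / (2 * R ^ 2))
  have h5 : (2 : ℝ) ^ d * 1 ≤ 2 ^ d * (Λ.card * (Real.exp (d / (2 * R ^ 2)))⁻¹) := by linarith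
  have h6 := le_of_mul_le_mul_left h5 h3
  rwa [← div_eq_mul_inv, le_div_iff₀ h4, one_mul] at h6

/-! ### Geometry of the cross-polytope and its two facets -/

lemma mem_crossPolytope_iff {d : ℕ} {x : Fin d → ℝ} :
    x ∈ crossPolytope d ↔ ∑ i, |x i| ≤ 1 := by
  classical
  constructor
  · intro h
    have := h (Finset.univ.filter fun i => 0 ≤ x i)
    refine le_trans (le_of_eq ?_) this
    rw [← Finset.sum_add_sum_compl (Finset.univ.filter fun i => 0 ≤ x i), sub_eq_add_neg,
      ← Finset.sum_neg_distrib]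
    congr 1
    · exact Finset.sum_congr rfl fun i hi => abs_of_nonneg (Finset.mem_filter.1 hi).2
    · exact Finset.sum_congr rfl fun i hi => abs_of_nonpos (by
        simp only [Finset.mem_compl, Finset.mem_filter, Finset.mem_univ, true_and, not_le] at hi
        exact hi.le)
  · intro h I
    refine le_trans ?_ h
    rw [← Finset.sum_add_sum_compl I, sub_eq_add_neg, ← Finset.sum_neg_distrib]
    exact add_le_add (Finset.sum_le_sum fun i _ => le_abs_self _)
      (Finset.sum_le_sum fun i _ => neg_le_abs _)

lemma neg_mem_crossPolytope {d : ℕ} {x : Fin d → ℝ} :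
    -x ∈ crossPolytope d ↔ x ∈ crossPolytope d := by
  simp [mem_crossPolytope_iff]

lemma neg_crossPolytope (d : ℕ) : -crossPolytope d = crossPolytope d :=
  Set.ext fun _ => neg_mem_crossPolytope

lemma single_mem_crossPolytope {d : ℕ} (i : Fin d) {s : ℝ} (hs : |s| ≤ 1) :
    Pi.single i s ∈ crossPolytope d := by
  rw [mem_crossPolytope_iff]
  refine le_trans (le_of_eq ?_) hs
  rw [Finset.sum_eq_single i (fun j _ hj => by simp [hj]) (by simp)]
  simp

lemma stdSimplex_subset_crossPolytope (d : ℕ) : stdSimplex ℝ (Fin d) ⊆ crossPolytope d := by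
  rintro x ⟨h0, h1⟩
  rw [mem_crossPolytope_iff, Finset.sum_congr rfl fun i _ => abs_of_nonneg (h0 i), h1]

lemma convex_crossPolytope (d : ℕ) : Convex ℝ (crossPolytope d) := by
  intro x hx y hy a b ha hb hab
  rw [mem_crossPolytope_iff] at *
  calc ∑ i, |(a • x + b • y) i| ≤ ∑ i, (a * |x i| + b * |y i|) := by
        refine Finset.sum_le_sum fun i _ => ?_
        refine (abs_add_le _ _).trans (le_of_eq ?_)
        simp [abs_mul, abs_of_nonneg ha, abs_of_nonneg hb]
    _ = a * ∑ i, |x i| + b * ∑ i, |y i| := by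
        rw [Finset.sum_add_distrib, Finset.mul_sum, Finset.mul_sum]
    _ ≤ a * 1 + b * 1 := by gcongr
    _ = 1 := by linarith

lemma convexHull_stdSimplex_union_neg {d : ℕ} (hd : 0 < d) :
    convexHull ℝ (stdSimplex ℝ (Fin d) ∪ -stdSimplex ℝ (Fin d)) = crossPolytope d := by
  classical
  refine Set.Subset.antisymm (convexHull_min (Set.union_subset (stdSimplex_subset_crossPolytope d)
    fun x hx => neg_mem_crossPolytope.1 (stdSimplex_subset_crossPolytope d hx))
    (convex_crossPolytope d)) fun x hx => ?_
  rw [mem_crossPolytope_iff] at hx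
  have hd' : (0 : ℝ) < d := Nat.cast_pos.2 hd
  -- The slack is spread evenly over the `2 * d` vertices; opposite vertices cancel, so the
  -- combination is still `x`.
  set δ : ℝ := (1 - ∑ i, |x i|) / (2 * d) with hδ
  have hδ0 : 0 ≤ δ := div_nonneg (by linarith) (by positivity)
  let w : Fin d × Bool → ℝ := fun q => δ + (|x q.1| + if q.2 then x q.1 else -x q.1) / 2
  let z : Fin d × Bool → Fin d → ℝ := fun q => Pi.single q.1 (if q.2 then 1 else -1)
  have hz : ∀ q, z q ∈ convexHull ℝ (stdSimplex ℝ (Fin d) ∪ -stdSimplex ℝ (Fin d)) := by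
    rintro ⟨i, b⟩
    refine subset_convexHull _ _ ?_
    cases b
    · right
      have := single_mem_stdSimplex ℝ i
      simpa [z, Set.mem_neg, ← Pi.single_neg] using this
    · left
      simpa [z] using single_mem_stdSimplex ℝ i
  have hw : ∀ q, 0 ≤ w q := by
    rintro ⟨i, b⟩
    have h1 := neg_le_abs (x i)
    have h2 := le_abs_self (x i)
    cases b <;> simp only [w] <;> simp <;> linarith
  have hw1 : ∑ q, w q = 1 := by
    rw [Fintype.sum_prod_type]
    have : ∀ i, ∑ b, w (i, b) = 2 * δ + |x i| := fun i => by simp [w]; ring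
    simp_rw [this]
    rw [Finset.sum_add_distrib, Finset.sum_const, Finset.card_univ, Fintype.card_fin, nsmul_eq_mul,
      hδ]
    field_simp
    ring
  have hx' : ∑ q, w q • z q = x := by
    rw [Fintype.sum_prod_type]
    have : ∀ i, ∑ b, w (i, b) • z (i, b) = Pi.single i (x i) := fun i => by
      simp only [Fintype.sum_bool, w, z, ← Pi.single_smul, ← Pi.single_add]
      congr 1
      simp
      ring
    simp_rw [this]
    exact Finset.univ_sum_single x
  rw [← hx']
  exact (convex_convexHull ℝ _).sum_mem (fun q _ => hw q) hw1 fun q _ => hz q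

lemma isPolytope_stdSimplex (d : ℕ) : IsPolytope (stdSimplex ℝ (Fin d)) := by
  classical
  exact ⟨_, Set.finite_range _, (convexHull_rangle_single_eq_stdSimplex ℝ (Fin d)).symm⟩

lemma IsPolytope.neg {E : Type*} [AddCommGroup E] [Module ℝ E] {P : Set E} (h : IsPolytope P) :
    IsPolytope (-P) := by
  obtain ⟨V, hV, rfl⟩ := h
  exact ⟨-V, hV.neg, (convexHull_neg V).symm⟩

lemma vectorSpan_neg {E : Type*} [AddCommGroup E] [Module ℝ E] (s : Set E) :
    vectorSpan ℝ (-s) = vectorSpan ℝ s := by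
  rw [vectorSpan_def, vectorSpan_def, ← Submodule.span_neg (s -ᵥ s)]
  congr 1
  ext x
  rw [Set.mem_neg]
  constructor
  · rintro ⟨a, ha, b, hb, rfl⟩
    exact ⟨-a, ha, -b, hb, by simp only [vsub_eq_sub]; abel⟩
  · rintro ⟨a, ha, b, hb, h⟩
    refine ⟨-a, by simpa using ha, -b, by simpa using hb, ?_⟩
    rw [← neg_inj, ← h]
    simp only [vsub_eq_sub]
    abel

lemma finrank_vectorSpan_stdSimplex {d : ℕ} (hd : 0 < d) :
    Module.finrank ℝ (vectorSpan ℝ (stdSimplex ℝ (Fin d))) + 1 = d := by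
  classical
  rw [← convexHull_rangle_single_eq_stdSimplex, ← direction_affineSpan, affineSpan_convexHull,
    direction_affineSpan,
    (Pi.linearIndependent_single_one (Fin d) ℝ).affineIndependent.finrank_vectorSpan
      (n := d - 1) (by simp; omega)]
  omega

lemma finrank_vectorSpan_crossPolytope (d : ℕ) :
    Module.finrank ℝ (vectorSpan ℝ (crossPolytope d)) = d := by
  classical
  have : vectorSpan ℝ (crossPolytope d) = ⊤ := by
    rw [eq_top_iff]
    intro x _
    rw [← Finset.univ_sum_single x]
    refine Submodule.sum_mem _ fun i _ => ?_
    have h := vsub_mem_vectorSpan ℝ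
      (single_mem_crossPolytope i (s := 1) (by simp)) (single_mem_crossPolytope i (s := 0) (by simp))
    have := Submodule.smul_mem _ (x i) h
    simpa [← Pi.single_smul] using this
  rw [this, finrank_top, Module.finrank_fintype_fun_eq_card, Fintype.card_fin]

lemma stdSimplex_eq_inter_crossPolytope (d : ℕ) :
    stdSimplex ℝ (Fin d) = {x ∈ crossPolytope d | 1 ≤ ∑ i, x i} := by
  ext x
  refine ⟨fun hx => ⟨stdSimplex_subset_crossPolytope d hx, hx.2.ge⟩, fun ⟨hx, h1⟩ => ?_⟩
  have hsum : ∑ i, x i = 1 :=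
    le_antisymm (by simpa using hx Finset.univ) h1
  refine ⟨fun j => ?_, hsum⟩
  -- Compared with `hsum`, flipping the sign of coordinate `j` alone forces `0 ≤ x j`.
  have := hx {j}ᶜ
  rw [← Finset.sum_add_sum_compl {j}] at hsum
  simp only [compl_compl, Finset.sum_singleton] at this hsum
  linarith

lemma isFacet_stdSimplex {d : ℕ} (hd : 0 < d) :
    IsFacet (crossPolytope d) (stdSimplex ℝ (Fin d)) := by
  classical
  refine ⟨⟨_, single_mem_stdSimplex ℝ (⟨0, hd⟩ : Fin d)⟩, fun _ => ?_,
    by rw [finrank_vectorSpan_stdSimplex hd, finrank_vectorSpan_crossPolytope]⟩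
  refine ⟨∑ i, ContinuousLinearMap.proj i, ?_⟩
  rw [stdSimplex_eq_inter_crossPolytope]
  ext x
  simp only [Set.mem_ofPred_eq, sum_apply, ContinuousLinearMap.proj_apply]
  refine and_congr_right fun hx => ⟨fun h y hy => ?_, fun h => ?_⟩
  · exact le_trans (by simpa using hy Finset.univ) h
  · simpa using h _ (single_mem_crossPolytope (⟨0, hd⟩ : Fin d) (s := 1) (by simp))

lemma IsFacet.neg {d : ℕ} {P F : Set (Fin d → ℝ)} (h : IsFacet P F) : IsFacet (-P) (-F) := by
  obtain ⟨hne, hexp, hdim⟩ := h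
  refine ⟨hne.neg, fun _ => ?_, by rwa [vectorSpan_neg, vectorSpan_neg]⟩
  obtain ⟨l, hl⟩ := hexp hne
  refine ⟨-l, ?_⟩
  ext x
  rw [Set.mem_neg, hl]
  simp only [Set.mem_ofPred_eq, Set.mem_neg, map_neg, neg_apply]
  exact and_congr_right fun _ => ⟨fun h y hy => by simpa using h (-y) hy,
    fun h y hy => by simpa using h (-y) (by simpa using hy)⟩

/-! ### Formulations of the simplices -/

/-- A system without additional variables is a formulation of the polytope it describes. -/
lemma isFormulationOf_of_no_additional {d f : ℕ} (A : Matrix (Fin f) (Fin d) ℝ) (b : Fin f → ℝ)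
    {P : Set (Fin d → ℝ)} (hP : Bornology.IsBounded P) (h : ∀ x, A *ᵥ x ≤ b ↔ x ∈ P) :
    (⟨A, 0, b⟩ : LinSystem d 0 f).IsFormulationOf P := by
  have hs : (⟨A, 0, b⟩ : LinSystem d 0 f).solutions = P ×ˢ Set.univ := by
    ext ⟨x, y⟩
    simp [LinSystem.solutions, h]
  refine ⟨?_, ?_⟩
  · rw [hs]
    exact hP.prod (Set.toFinite _).isBounded
  · rw [hs, Set.fst_image_prod _ Set.univ_nonempty]

lemma exists_formulation_stdSimplex (d : ℕ) :
    ∃ F : LinSystem d 0 (d + 2), F.IsFormulationOf (stdSimplex ℝ (Fin d)) := by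
  refine ⟨_, isFormulationOf_of_no_additional
    (Matrix.of (Fin.cons 1 (Fin.cons (-1) fun i => (-1 : Matrix (Fin d) (Fin d) ℝ) i)))
    (Fin.cons 1 (Fin.cons (-1) 0)) (bounded_stdSimplex (Fin d)) fun x => ?_⟩
  rw [Pi.le_def, Fin.forall_fin_succ, Fin.forall_fin_succ]
  have hrow : ∀ i, (fun j => (-1 : Matrix (Fin d) (Fin d) ℝ) i j) ⬝ᵥ x = - x i := fun i => by
    have : ((-1 : Matrix (Fin d) (Fin d) ℝ) *ᵥ x) i = - x i := by
      rw [Matrix.neg_mulVec, Matrix.one_mulVec]; rfl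
    exact this
  simp only [Matrix.mulVec, Matrix.of_apply, Fin.cons_zero, Fin.cons_succ, hrow, Pi.zero_apply,
    Left.neg_nonpos_iff, one_dotProduct, neg_dotProduct]
  refine ⟨fun ⟨h1, h2, h3⟩ => ⟨h3, by linarith⟩, fun ⟨h3, h1⟩ => ⟨h1.le, by rw [h1], h3⟩⟩

lemma LinSystem.IsFormulationOf.neg {d m f : ℕ} {F : LinSystem d m f} {P : Set (Fin d → ℝ)}
    (h : F.IsFormulationOf P) : (⟨-F.A, F.B, F.b⟩ : LinSystem d m f).IsFormulationOf (-P) := by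
  obtain ⟨hb, hP⟩ := h
  have hs : ∀ x y, (x, y) ∈ (⟨-F.A, F.B, F.b⟩ : LinSystem d m f).solutions ↔
      (-x, y) ∈ F.solutions := fun x y => by
    simp [LinSystem.solutions, Matrix.neg_mulVec, Matrix.mulVec_neg]
  refine ⟨?_, ?_⟩
  · obtain ⟨C, hC⟩ := isBounded_iff_forall_norm_le.1 hb
    refine isBounded_iff_forall_norm_le.2 ⟨C, ?_⟩
    rintro ⟨x, y⟩ hz
    simpa [Prod.norm_def] using hC _ ((hs x y).1 hz)
  · rw [← hP]
    ext x
    simp only [Set.mem_image, Prod.exists, exists_and_right, exists_eq_right, Set.mem_neg, hs]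

/-! ### Points excluded from approximations -/

/-- An `ε`-approximation of the cross-polytope contains none of the points
`((2 + 2 ε) / d) • {±1} ^ d`. -/
lemma IsApproximation.notMem_of_crossPolytope {d : ℕ} {ε : ℝ} {P' : Set (Fin d → ℝ)} (hd : 0 < d)
    (hε : 0 < ε) (h : IsApproximation ε (crossPolytope d) P') (c : Fin d → Bool) :
    (d / (2 + 2 * ε))⁻¹ • signVec c ∉ P' := by
  intro hx
  have hd' : (0 : ℝ) < d := Nat.cast_pos.2 hd
  have habs : ∀ i, |signVec c i| = 1 := fun i => by unfold signVec; split_ifs <;> simp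
  have hval : signVec c ⬝ᵥ ((d / (2 + 2 * ε))⁻¹ • signVec c) = 2 + 2 * ε := by
    have : signVec c ⬝ᵥ signVec c = d := by
      simp [dotProduct, ← sq, ← sq_abs (signVec c _), habs]
    rw [dotProduct_smul, this, smul_eq_mul]
    field_simp
  have hle : ∀ x ∈ crossPolytope d, |signVec c ⬝ᵥ x| ≤ 1 := fun x hx => by
    refine le_trans ?_ (mem_crossPolytope_iff.1 hx)
    refine (Finset.abs_sum_le_sum_abs _ _).trans (le_of_eq ?_)
    exact Finset.sum_congr rfl fun i _ => by rw [abs_mul, habs, one_mul]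
  have hbdd : Bornology.IsBounded ((fun x => signVec c ⬝ᵥ x) '' P') := by
    obtain ⟨V, hV, rfl⟩ := h.polytope'
    exact (hV.isCompact_convexHull (𝕜 := ℝ) |>.image (by fun_prop)).isBounded
  have hne : ((fun x => signVec c ⬝ᵥ x) '' crossPolytope d).Nonempty := h.nonempty.image _
  have h1 : dirWidth (signVec c) (crossPolytope d) ≤ 2 := by
    have a1 : sSup ((fun x => signVec c ⬝ᵥ x) '' crossPolytope d) ≤ 1 :=
      csSup_le hne (by rintro _ ⟨x, hx, rfl⟩; exact (abs_le.1 (hle x hx)).2)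
    have a2 : -1 ≤ sInf ((fun x => signVec c ⬝ᵥ x) '' crossPolytope d) :=
      le_csInf hne (by rintro _ ⟨x, hx, rfl⟩; exact (abs_le.1 (hle x hx)).1)
    unfold dirWidth
    linarith
  have h2 : 2 + 2 * ε ≤ sSup ((fun x => signVec c ⬝ᵥ x) '' P') :=
    le_csSup hbdd.bddAbove ⟨_, hx, hval⟩
  have h3 : sInf ((fun x => signVec c ⬝ᵥ x) '' P') ≤ 0 :=
    csInf_le hbdd.bddBelow ⟨0, h.subset (by simp [mem_crossPolytope_iff]), by simp⟩
  have h4 := h.width_le (signVec c)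
  -- The bound `h3` only gives width at least `2 + 2 * ε`, which is allowed; a vertex of value `-1`
  -- makes the excess strict.
  have h5 : sInf ((fun x => signVec c ⬝ᵥ x) '' P') ≤ -1 := by
    refine csInf_le_of_le hbdd.bddBelow ⟨Pi.single ⟨0, hd⟩ (-signVec c ⟨0, hd⟩),
      h.subset (single_mem_crossPolytope _ (by simp [habs])), rfl⟩ (le_of_eq ?_)
    simp only [dotProduct_single, mul_neg]
    rw [← sq, ← sq_abs, habs, one_pow]
  have h6 : (1 + ε) * dirWidth (signVec c) (crossPolytope d) ≤ (1 + ε) * 2 :=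
    mul_le_mul_of_nonneg_left h1 (by linarith)
  have h7 : dirWidth (signVec c) P' = sSup ((fun x => signVec c ⬝ᵥ x) '' P') -
    sInf ((fun x => signVec c ⬝ᵥ x) '' P') := rfl
  linarith

/-! ### Asymptotics and the main theorem -/

open Filter Polynomial in
/-- A polynomial is eventually dominated by a power. -/
lemma Polynomial.exists_eventually_eval_le_pow (p : ℝ[X]) :
    ∃ k : ℕ, 0 < k ∧ ∀ᶠ x : ℝ in atTop, p.eval x ≤ x ^ k := by
  -- The extra factor `x` absorbs the big-O constant.
  refine ⟨p.natDegree + 1, Nat.succ_pos _, ?_⟩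
  have h : p.degree ≤ ((X : ℝ[X]) ^ p.natDegree).degree := by
    rw [degree_X_pow]; exact degree_le_natDegree
  obtain ⟨K, hK⟩ := (isBigO_atTop_of_degree_le p _ h).bound
  filter_upwards [hK, eventually_ge_atTop K, eventually_ge_atTop 0] with x h1 h2 h3
  simp only [eval_pow, eval_X, Real.norm_eq_abs, abs_pow, abs_of_nonneg h3] at h1
  calc p.eval x ≤ |p.eval x| := le_abs_self _
    _ ≤ K * x ^ p.natDegree := h1
    _ ≤ x * x ^ p.natDegree := by gcongr
    _ = x ^ (p.natDegree + 1) := by ring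

open Filter in
theorem theorem3 (ε : ℝ) (hε : 0 < ε) (σ : Polynomial ℝ) :
    ∃ c : ℝ, 0 < c ∧ ∃ d₀ : ℕ, ∀ d : ℕ, 1 ≤ d →
      ∃ P₁ P₂ : Set (Fin d → ℝ),
        -- `P₁` is the standard simplex, `P₂` its negative
        P₁ = stdSimplex ℝ (Fin d) ∧ P₂ = -P₁ ∧
        IsPolytope P₁ ∧ P₁.Nonempty ∧ IsPolytope P₂ ∧ P₂.Nonempty ∧
        -- they are facets of the cross-polytope, which is the convex hull of their union
        IsFacet (crossPolytope d) P₁ ∧ IsFacet (crossPolytope d) P₂ ∧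
        convexHull ℝ (P₁ ∪ P₂) = crossPolytope d ∧
        ∃ (m₁ f₁ : ℕ) (F₁ : LinSystem d m₁ f₁) (m₂ f₂ : ℕ) (F₂ : LinSystem d m₂ f₂),
          F₁.IsFormulationOf P₁ ∧ F₂.IsFormulationOf P₂ ∧
          (d₀ ≤ d → ∀ (P' : Set (Fin d → ℝ)) (m f : ℕ) (F : LinSystem d m f),
            IsApproximation ε (convexHull ℝ (P₁ ∪ P₂)) P' →
            F.IsFormulationOf P' →
            (f : ℝ) ≤ σ.eval ((f₁ : ℝ) + (f₂ : ℝ)) →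
            c * ((d : ℝ) / Real.log (d : ℝ)) ≤ (m : ℝ)) := by
  obtain ⟨k, hk, hpow⟩ := Polynomial.exists_eventually_eval_le_pow
    -- The sizes sum to `2 * d + 4`, and the count involves `f + 1`.
    (σ.comp (2 * Polynomial.X + 4) + 1)
  have hR : 0 < 2 + 2 * ε := by linarith
  have hk' : (0 : ℝ) < k := Nat.cast_pos.2 hk
  -- Half the constant that the logarithms give: they yield `2 * c * d / log d ≤ m + 1`, and the
  -- spare half absorbs the `1` once `log d ≤ c * d`.
  set c : ℝ := 1 / (4 * (2 + 2 * ε) ^ 2 * k) with hc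
  have hc0 : 0 < c := by positivity
  have hlog := Real.isLittleO_log_id_atTop.bound hc0
  obtain ⟨d₀, hd₀⟩ := eventually_atTop.1
    (tendsto_natCast_atTop_atTop.eventually (hpow.and (hlog.and (eventually_gt_atTop 1))))
  refine ⟨c, hc0, d₀, fun d hd => ⟨_, _, rfl, rfl, isPolytope_stdSimplex d,
    (isFacet_stdSimplex hd).1, (isPolytope_stdSimplex d).neg, (isFacet_stdSimplex hd).1.neg,
    isFacet_stdSimplex hd, neg_crossPolytope d ▸ (isFacet_stdSimplex hd).neg,
    convexHull_stdSimplex_union_neg hd, ?_⟩⟩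
  obtain ⟨F₁, hF₁⟩ := exists_formulation_stdSimplex d
  refine ⟨0, d + 2, F₁, 0, d + 2, _, hF₁, hF₁.neg, fun hdd P' m f F happ hF hf => ?_⟩
  rw [convexHull_stdSimplex_union_neg hd] at happ
  obtain ⟨hp, hl, h1⟩ := hd₀ d hdd
  have hexp := exp_le_of_projection F hR hd
    (fun i s hs => by rw [hF.2]; exact happ.subset (single_mem_crossPolytope i hs.le))
    (fun b => by rw [hF.2]; exact happ.notMem_of_crossPolytope hd hε b)
  have hlog0 : 0 < Real.log d := Real.log_pos h1
  have hf' : (f : ℝ) + 1 ≤ (d : ℝ) ^ k := by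
    refine le_trans ?_ hp
    have : ((d + 2 : ℕ) : ℝ) + ((d + 2 : ℕ) : ℝ) = 2 * d + 4 := by push_cast; ring
    rw [this] at hf
    simpa using hf
  have hexp' : Real.exp (d / (2 * (2 + 2 * ε) ^ 2)) ≤ (d : ℝ) ^ (k * (m + 1)) := by
    rw [pow_mul]
    exact hexp.trans (pow_le_pow_left₀ (by positivity) hf' _)
  have hle := Real.log_le_log (Real.exp_pos _) hexp'
  rw [Real.log_exp, Real.log_pow] at hle
  simp only [id, Real.norm_eq_abs, abs_of_pos hlog0, Nat.abs_cast] at hl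
  have hone : 1 ≤ c * (d / Real.log d) := by
    rw [mul_div_assoc', le_div_iff₀ hlog0]
    linarith
  have htwo : 2 * (c * (d / Real.log d)) ≤ m + 1 := by
    rw [mul_div_assoc', mul_div_assoc', div_le_iff₀ hlog0]
    push_cast at hle
    have he : 2 * (c * d) = d / (2 * (2 + 2 * ε) ^ 2) / k := by
      rw [hc]; field_simp; norm_num
    rw [he, div_le_iff₀ hk']
    linarith
  linarith
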